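/- Let $\Theta=(\Sigma,\varphi)$ be a connected $\mathbb{T}$-gain graph on a finite vertex set $V$ with $|V|=n$: $\Sigma$ is a connected simple graph, and $\varphi$ assigns to every oriented edge a complex number of modulus $1$ so that opposite orientations receive inverse values. The gain $\varphi(P)$ of a walk $P$ is the product of the gains of its oriented edges, and $\Theta$ is called balanced if every cycle has gain $1$. Let $d$ be the graph distance of $\Sigma$ and let $<$ be any strict total ordering of $V$. For $y<z$ let $\varphi^{\max}_<(y,z)$ (respectively $\varphi^{\min}_<(y,z)$) be the largest (respectively smallest) of the gains $\varphi(P)$ of the shortest paths $P$ from $y$ to $z$ in the lexicographic order on $\mathbb{C}$ (compare real parts first, then imaginary parts); put $\varphi^{\max}_<(z,y)=\overline{\varphi^{\max}_<(y,z)}$ and $\varphi^{\max}_<(y,y)=0$, and similarly for $\min$. Let $\mathrm{Tr}$ be the diagonal matrix with entries $\sum_{x'\in V}d(x,x')$, and define the gain distance Laplacian matrices $$DL^{\max}_<(\Theta)=\mathrm{Tr}-\bigl(\varphi^{\max}_<(y,z)\,d(y,z)\bigr)_{y,z\in V},\qquad DL^{\min}_<(\Theta)=\mathrm{Tr}-\bigl(\varphi^{\min}_<(y,z)\,d(y,z)\bigr)_{y,z\in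 V}.$$ Then the following are equivalent: (i) $\det DL^{\max}_<(\Theta)=0$; (ii) $\det DL^{\min}_<(\Theta)=0$; (iii) $DL^{\max}_<(\Theta)=DL^{\min}_<(\Theta)$, and this common matrix $DL(\Theta)$ satisfies $\det DL(\Theta)=0$; (iv) $\Theta$ is balanced. Moreover, both $DL^{\max}_<(\Theta)$ and $DL^{\min}_<(\Theta)$ have rank $n-1$ if $\Theta$ is balanced and rank $n$ if $\Theta$ is unbalanced. If $\Theta$ is balanced, these matrices do not depend on the ordering $<$. -/

import Mathlib

/-- A complex unit gain graph (`𝕋`-gain graph) on the vertex set `V`: a simple graph together with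
a map assigning to each oriented edge (dart) a complex number of modulus one, such that the
opposite orientation gets the inverse. -/
structure TGainGraph (V : Type*) where
  /-- the underlying graph -/
  graph : SimpleGraph V
  /-- the gain function on oriented edges -/
  gain : graph.Dart → Circle
  gain_symm : ∀ d : graph.Dart, gain d.symm = (gain d)⁻¹

namespace TGainGraph

variable {V : Type*} (Θ : TGainGraph V)

/-- The gain of a walk: the product of the gains of its oriented edges. -/
noncomputable def walkGain {y z : V} (p : Θ.graph.Walk y z) : Circle :=
  (p.darts.map Θ.gain).prod

/-- A gain graph is balanced if every (oriented) cycle has gain `1`. -/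
def Balanced : Prop :=
  ∀ (v : V) (c : Θ.graph.Walk v v), c.IsCycle → Θ.walkGain c = 1

/-- The set of shortest oriented paths from `y` to `z`. -/
def shortestPaths (y z : V) : Set (Θ.graph.Walk y z) :=
  {p | p.IsPath ∧ p.length = Θ.graph.dist y z}

/-- The shortest paths from `y` to `z` whose gain has maximum real part. -/
def maxPaths (y z : V) : Set (Θ.graph.Walk y z) :=
  {p | p ∈ Θ.shortestPaths y z ∧
    ∀ q ∈ Θ.shortestPaths y z, (Θ.walkGain q : ℂ).re ≤ (Θ.walkGain p : ℂ).re}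

/-- The shortest paths from `y` to `z` whose gain has minimum real part. -/
def minPaths (y z : V) : Set (Θ.graph.Walk y z) :=
  {p | p ∈ Θ.shortestPaths y z ∧
    ∀ q ∈ Θ.shortestPaths y z, (Θ.walkGain p : ℂ).re ≤ (Θ.walkGain q : ℂ).re}

theorem finite_shortestPaths [Finite V] (y z : V) : (Θ.shortestPaths y z).Finite := by
  classical
  have := Fintype.ofFinite V
  refine Set.Finite.subset
    (Set.toFinite {p : Θ.graph.Walk y z | p.length = Θ.graph.dist y z}) ?_
  exact fun p hp => hp.2

theorem nonempty_shortestPaths (h : Θ.graph.Connected) (y z : V) :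
    (Θ.shortestPaths y z).Nonempty := by
  obtain ⟨p, hp, hl⟩ := h.exists_path_of_dist y z
  exact ⟨p, hp, hl⟩

/-- In a finite connected gain graph, there is a path that maximizes the imaginary part of the gain
among the shortest paths of maximum real part; so `lexMaxGain` below is really a maximum. -/
theorem exists_lexMax [Finite V] (h : Θ.graph.Connected) (y z : V) :
    ∃ p ∈ Θ.maxPaths y z, ∀ q ∈ Θ.maxPaths y z,
      (Θ.walkGain q : ℂ).im ≤ (Θ.walkGain p : ℂ).im := by
  obtain ⟨p, hp, hm⟩ := Set.exists_max_image _ (fun q => (Θ.walkGain q : ℂ).re)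
    (Θ.finite_shortestPaths y z) (Θ.nonempty_shortestPaths h y z)
  exact Set.exists_max_image _ (fun q => (Θ.walkGain q : ℂ).im)
    ((Θ.finite_shortestPaths y z).subset fun q hq => hq.1) ⟨p, hp, hm⟩

/-- The analogous fact for minima. -/
theorem exists_lexMin [Finite V] (h : Θ.graph.Connected) (y z : V) :
    ∃ p ∈ Θ.minPaths y z, ∀ q ∈ Θ.minPaths y z,
      (Θ.walkGain p : ℂ).im ≤ (Θ.walkGain q : ℂ).im := by
  obtain ⟨p, hp, hm⟩ := Set.exists_min_image _ (fun q => (Θ.walkGain q : ℂ).re)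
    (Θ.finite_shortestPaths y z) (Θ.nonempty_shortestPaths h y z)
  exact Set.exists_min_image _ (fun q => (Θ.walkGain q : ℂ).im)
    ((Θ.finite_shortestPaths y z).subset fun q hq => hq.1) ⟨p, hp, hm⟩

open Classical in
/-- The lexicographically (first real, then imaginary part) largest gain of a shortest path from
`y` to `z`. The value `0` is taken only if there is no such path, which does not happen in finite
connected graphs, by `exists_lexMax`. -/
noncomputable def lexMaxGain (y z : V) : ℂ :=
  if h : ∃ p ∈ Θ.maxPaths y z, ∀ q ∈ Θ.maxPaths y z,
      (Θ.walkGain q : ℂ).im ≤ (Θ.walkGain p : ℂ).im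
  then (Θ.walkGain h.choose : ℂ) else 0

open Classical in
/-- The lexicographically smallest gain of a shortest path from `y` to `z`. -/
noncomputable def lexMinGain (y z : V) : ℂ :=
  if h : ∃ p ∈ Θ.minPaths y z, ∀ q ∈ Θ.minPaths y z,
      (Θ.walkGain p : ℂ).im ≤ (Θ.walkGain q : ℂ).im
  then (Θ.walkGain h.choose : ℂ) else 0

open Classical in
/-- The maximum auxiliary gain with respect to a vertex ordering `lt`: `0` on the diagonal, the
largest gain of a shortest path from `y` to `z` if `lt y z`, and the complex conjugate of the value
at `(z, y)` otherwise. -/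
noncomputable def maxAuxGain (lt : V → V → Prop) (y z : V) : ℂ :=
  if y = z then 0
  else if lt y z then Θ.lexMaxGain y z
  else (starRingEnd ℂ) (Θ.lexMaxGain z y)

open Classical in
/-- The minimum auxiliary gain with respect to a vertex ordering `lt`. -/
noncomputable def minAuxGain (lt : V → V → Prop) (y z : V) : ℂ :=
  if y = z then 0
  else if lt y z then Θ.lexMinGain y z
  else (starRingEnd ℂ) (Θ.lexMinGain z y)

/-- The maximum gain distance matrix. -/
noncomputable def maxDistMatrix (lt : V → V → Prop) : Matrix V V ℂ :=
  Matrix.of fun y z => Θ.maxAuxGain lt y z * (Θ.graph.dist y z : ℂ)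

/-- The minimum gain distance matrix. -/
noncomputable def minDistMatrix (lt : V → V → Prop) : Matrix V V ℂ :=
  Matrix.of fun y z => Θ.minAuxGain lt y z * (Θ.graph.dist y z : ℂ)

/-- The transmission matrix: the diagonal matrix of the sums of distances. -/
noncomputable def transmissionMatrix [Fintype V] [DecidableEq V] : Matrix V V ℂ :=
  Matrix.diagonal fun x => ∑ x' : V, (Θ.graph.dist x x' : ℂ)

/-- The maximum gain distance Laplacian matrix. -/
noncomputable def maxDistLaplacian [Fintype V] [DecidableEq V] (lt : V → V → Prop) :
    Matrix V V ℂ :=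
  Θ.transmissionMatrix - Θ.maxDistMatrix lt

/-- The minimum gain distance Laplacian matrix. -/
noncomputable def minDistLaplacian [Fintype V] [DecidableEq V] (lt : V → V → Prop) :
    Matrix V V ℂ :=
  Θ.transmissionMatrix - Θ.minDistMatrix lt

end TGainGraph

/-! Both matrices are treated as one case: `g` selects, for each pair of distinct vertices, the gain
of some shortest path. The engine is a maximum principle, `IsShortestGain.mulVec_eq_zero_iff`. If
`x` is in the kernel and `‖x y‖` is maximal, the row equation `∑ z, d(y,z) (x y - g y z * x z) = 0`
forces every term to vanish, so all moduli agree and the same holds in every row. On edges `g` is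
the gain itself, so a nonzero kernel vector is a potential for the gains, and balance follows.
Conversely, under balance walk gains depend only on the ends, and the gains of walks to a fixed root
span the kernel. -/

theorem Complex.half_normSq_sub_le {a b : ℂ} (h : ‖b‖ ≤ ‖a‖) :
    Complex.normSq (a - b) / 2 ≤ ((starRingEnd ℂ) a * (a - b)).re := by
  have h' : Complex.normSq b ≤ Complex.normSq a := by
    rw [Complex.normSq_eq_norm_sq, Complex.normSq_eq_norm_sq]
    gcongr
  simp only [Complex.normSq_apply, Complex.sub_re, Complex.sub_im, Complex.mul_re,
    Complex.conj_re, Complex.conj_im] at h' ⊢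
  linarith

namespace TGainGraph

variable {V : Type*} (Θ : TGainGraph V)

/-! ### Walk gains and balance -/

@[simp]
theorem walkGain_nil (v : V) : Θ.walkGain (SimpleGraph.Walk.nil : Θ.graph.Walk v v) = 1 := by
  simp [walkGain]

@[simp]
theorem walkGain_cons {u v w : V} (h : Θ.graph.Adj u v) (p : Θ.graph.Walk v w) :
    Θ.walkGain (SimpleGraph.Walk.cons h p) = Θ.gain ⟨(u, v), h⟩ * Θ.walkGain p := by
  simp [walkGain]

theorem walkGain_append {u v w : V} (p : Θ.graph.Walk u v) (q : Θ.graph.Walk v w) :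
    Θ.walkGain (p.append q) = Θ.walkGain p * Θ.walkGain q := by
  simp [walkGain, SimpleGraph.Walk.darts_append]

theorem walkGain_reverse {u v : V} (p : Θ.graph.Walk u v) :
    Θ.walkGain p.reverse = (Θ.walkGain p)⁻¹ := by
  induction p with
  | nil => simp
  | cons h p ih =>
    have hs := Θ.gain_symm ⟨(_, _), h⟩
    rw [SimpleGraph.Walk.reverse_cons, walkGain_append, ih, walkGain_cons, walkGain_cons,
      walkGain_nil, mul_inv_rev, mul_one]
    exact congrArg _ hs

variable {Θ}

/-- In a balanced gain graph, closing a path by an edge gives gain `1`. -/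
theorem Balanced.gain_mul_walkGain_path (hb : Θ.Balanced) {u v : V} (h : Θ.graph.Adj u v)
    (p : Θ.graph.Walk v u) (hp : p.IsPath) : Θ.gain ⟨(u, v), h⟩ * Θ.walkGain p = 1 := by
  -- A path from `v` can use the edge `uv` only as its first step, and then it is that edge alone;
  -- otherwise closing it up gives a cycle.
  by_cases he : s(u, v) ∈ p.edges
  · cases p with
    | nil => simp at he
    | cons h' q =>
      rw [SimpleGraph.Walk.cons_isPath_iff] at hp
      rw [SimpleGraph.Walk.edges_cons, List.mem_cons] at he
      rcases he with he | he
      · rw [Sym2.eq_swap, Sym2.congr_right] at he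
        subst he
        rw [(SimpleGraph.Walk.isPath_iff_nil.mp hp.1).eq_nil, walkGain_cons, walkGain_nil, mul_one]
        exact mul_eq_one_iff_eq_inv'.mpr (Θ.gain_symm ⟨(u, v), h⟩)
      · exact absurd (q.snd_mem_support_of_mem_edges he) hp.2
  · rw [← walkGain_cons]
    exact hb u _ ((p.cons_isCycle_iff h).mpr ⟨hp, he⟩)

theorem Balanced.walkGain_bypass [DecidableEq V] (hb : Θ.Balanced) {u v : V}
    (p : Θ.graph.Walk u v) : Θ.walkGain p.bypass = Θ.walkGain p := by
  induction p with
  | nil => simp [SimpleGraph.Walk.bypass]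
  | @cons u v w h p ih =>
    rw [SimpleGraph.Walk.bypass, walkGain_cons, ← ih]
    split_ifs with hs
    -- The piece cut out is a path back to `u` closed by the edge `h`, so its gain is `1`.
    · conv_rhs => rw [← p.bypass.take_spec hs, walkGain_append, ← mul_assoc,
        hb.gain_mul_walkGain_path h _ (p.bypass_isPath.takeUntil hs), one_mul]
    · rw [walkGain_cons]

theorem Balanced.walkGain_closed (hb : Θ.Balanced) {v : V} (p : Θ.graph.Walk v v) :
    Θ.walkGain p = 1 := by
  classical
  rw [← hb.walkGain_bypass, (SimpleGraph.Walk.isPath_iff_nil.mp p.bypass_isPath).eq_nil, walkGain_nil]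

/-- In a balanced gain graph, the gain of a walk depends only on its ends. -/
theorem Balanced.walkGain_eq (hb : Θ.Balanced) {u v : V} (p q : Θ.graph.Walk u v) :
    Θ.walkGain p = Θ.walkGain q := by
  have h := hb.walkGain_closed (p.append q.reverse)
  rwa [walkGain_append, walkGain_reverse, mul_inv_eq_one] at h

variable (Θ)

/-! ### Selections of shortest-path gains -/

/-- `g` assigns to each pair of distinct vertices the gain of some shortest path. -/
def IsShortestGain (g : V → V → ℂ) : Prop :=
  ∀ y z, y ≠ z → ∃ p ∈ Θ.shortestPaths y z, g y z = Θ.walkGain p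

theorem lexMaxGain_eq_walkGain [Finite V] (h : Θ.graph.Connected) (y z : V) :
    ∃ p ∈ Θ.shortestPaths y z, Θ.lexMaxGain y z = Θ.walkGain p := by
  have hex := Θ.exists_lexMax h y z
  exact ⟨hex.choose, hex.choose_spec.1.1, by rw [lexMaxGain, dif_pos hex]⟩

theorem lexMinGain_eq_walkGain [Finite V] (h : Θ.graph.Connected) (y z : V) :
    ∃ p ∈ Θ.shortestPaths y z, Θ.lexMinGain y z = Θ.walkGain p := by
  have hex := Θ.exists_lexMin h y z
  exact ⟨hex.choose, hex.choose_spec.1.1, by rw [lexMinGain, dif_pos hex]⟩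

variable {Θ} in
theorem conj_eq_walkGain {y z : V} {a : ℂ} (h : ∃ p ∈ Θ.shortestPaths z y, a = Θ.walkGain p) :
    ∃ p ∈ Θ.shortestPaths y z, (starRingEnd ℂ) a = Θ.walkGain p := by
  obtain ⟨p, ⟨hp, hl⟩, rfl⟩ := h
  refine ⟨p.reverse, ⟨hp.reverse, ?_⟩, ?_⟩
  · rw [SimpleGraph.Walk.length_reverse, hl, SimpleGraph.dist_comm]
  · rw [walkGain_reverse, Circle.coe_inv_eq_conj]

theorem isShortestGain_maxAuxGain [Finite V] (h : Θ.graph.Connected) (lt : V → V → Prop) :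
    Θ.IsShortestGain (Θ.maxAuxGain lt) := by
  intro y z hyz
  rw [maxAuxGain, if_neg hyz]
  split_ifs
  · exact Θ.lexMaxGain_eq_walkGain h y z
  · exact conj_eq_walkGain (Θ.lexMaxGain_eq_walkGain h z y)

theorem isShortestGain_minAuxGain [Finite V] (h : Θ.graph.Connected) (lt : V → V → Prop) :
    Θ.IsShortestGain (Θ.minAuxGain lt) := by
  intro y z hyz
  rw [minAuxGain, if_neg hyz]
  split_ifs
  · exact Θ.lexMinGain_eq_walkGain h y z
  · exact conj_eq_walkGain (Θ.lexMinGain_eq_walkGain h z y)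

variable {Θ} in
theorem IsShortestGain.norm_eq_one {g : V → V → ℂ} (hg : Θ.IsShortestGain g) {y z : V} (h : y ≠ z) :
    ‖g y z‖ = 1 := by
  obtain ⟨p, -, hp⟩ := hg y z h
  rw [hp, Circle.norm_coe]

-- At distance one the edge is the only shortest path, so the selection has no freedom there.
variable {Θ} in
theorem IsShortestGain.eq_gain_of_adj {g : V → V → ℂ} (hg : Θ.IsShortestGain g) {y z : V}
    (h : Θ.graph.Adj y z) : g y z = Θ.gain ⟨(y, z), h⟩ := by
  obtain ⟨p, ⟨-, hl⟩, hp⟩ := hg y z h.ne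
  rw [SimpleGraph.dist_eq_one_iff_adj.mpr h] at hl
  rw [hp]
  cases p with
  | nil => simp at hl
  | cons h' q =>
    cases q with
    | nil => simp
    | cons h'' q => simp at hl

/-! ### Kernel and rank of the distance Laplacian -/

/-- The distance Laplacian matrix of an arbitrary auxiliary gain function. -/
noncomputable def distLaplacian [Fintype V] [DecidableEq V] (g : V → V → ℂ) : Matrix V V ℂ :=
  Θ.transmissionMatrix - Matrix.of fun y z => g y z * (Θ.graph.dist y z : ℂ)

section Laplacian

variable [Fintype V] [DecidableEq V] {Θ} {g : V → V → ℂ}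

theorem distLaplacian_mulVec (g : V → V → ℂ) (x : V → ℂ) (y : V) :
    (Θ.distLaplacian g).mulVec x y = ∑ z, (Θ.graph.dist y z : ℂ) * (x y - g y z * x z) := by
  rw [distLaplacian, transmissionMatrix, Matrix.sub_mulVec, Pi.sub_apply,
    Matrix.mulVec_diagonal, Finset.sum_mul, Matrix.mulVec, dotProduct, ← Finset.sum_sub_distrib]
  refine Finset.sum_congr rfl fun z _ => ?_
  rw [Matrix.of_apply]
  ring

/-- After multiplying row `y` by the conjugate of `x y`, the real part of each term is at least
`d(y,z) * |x y - g y z * x z|² / 2`, yet the terms sum to zero. -/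
theorem IsShortestGain.eq_mul_of_max (hΘ : Θ.graph.Connected) (hg : Θ.IsShortestGain g)
    {x : V → ℂ} {y : V} (hx : (Θ.distLaplacian g).mulVec x y = 0)
    (hy : ∀ z, ‖x z‖ ≤ ‖x y‖) {z : V} (hz : y ≠ z) : x y = g y z * x z := by
  rw [distLaplacian_mulVec] at hx
  have hle : ∀ z, Θ.graph.dist y z * (Complex.normSq (x y - g y z * x z) / 2) ≤
      ((starRingEnd ℂ) (x y) * ((Θ.graph.dist y z : ℂ) * (x y - g y z * x z))).re := by
    intro z
    -- `g y y` is unconstrained, but its coefficient `d(y,y)` is zero.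
    rcases eq_or_ne y z with rfl | h
    · simp
    · rw [mul_left_comm, ← Complex.ofReal_natCast, Complex.re_ofReal_mul]
      refine mul_le_mul_of_nonneg_left (Complex.half_normSq_sub_le ?_) (Nat.cast_nonneg _)
      rw [norm_mul, hg.norm_eq_one h, one_mul]
      exact hy z
  have hsum := Finset.sum_le_sum fun z (_ : z ∈ Finset.univ) => hle z
  rw [← Complex.re_sum, ← Finset.mul_sum, hx, mul_zero, Complex.zero_re] at hsum
  have hnonneg : ∀ z ∈ Finset.univ,
      0 ≤ Θ.graph.dist y z * (Complex.normSq (x y - g y z * x z) / 2) := fun z _ =>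
    mul_nonneg (Nat.cast_nonneg _) (div_nonneg (Complex.normSq_nonneg _) zero_le_two)
  have h0 := (Finset.sum_eq_zero_iff_of_nonneg hnonneg).mp
    (le_antisymm hsum (Finset.sum_nonneg hnonneg)) z (Finset.mem_univ z)
  have hd : (Θ.graph.dist y z : ℝ) ≠ 0 := Nat.cast_ne_zero.mpr (hΘ.pos_dist_of_ne hz).ne'
  rw [mul_eq_zero_iff_left hd, div_eq_zero_iff, or_iff_left two_ne_zero,
    Complex.normSq_eq_zero, sub_eq_zero] at h0
  exact h0

/-- Kernel vectors of the distance Laplacian are equivariant along the auxiliary gains. -/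
theorem IsShortestGain.mulVec_eq_zero_iff (hΘ : Θ.graph.Connected) (hg : Θ.IsShortestGain g)
    (x : V → ℂ) :
    (Θ.distLaplacian g).mulVec x = 0 ↔ ∀ y z, y ≠ z → x y = g y z * x z := by
  constructor
  · intro hx y z hyz
    have := hΘ.nonempty
    obtain ⟨m, hm⟩ := Finite.exists_max fun v => ‖x v‖
    refine hg.eq_mul_of_max hΘ (congrFun hx y) (fun v => ?_) hyz
    rcases eq_or_ne m y with rfl | hmy
    · exact hm v
    -- The relation in row `m` gives `‖x m‖ = ‖x y‖`, so `y` attains the maximum too.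
    · have h := hg.eq_mul_of_max hΘ (congrFun hx m) hm hmy
      have h' := congrArg norm h
      rw [norm_mul, hg.norm_eq_one hmy, one_mul] at h'
      exact h' ▸ hm v
  · intro hx
    ext y
    rw [distLaplacian_mulVec, Pi.zero_apply]
    refine Finset.sum_eq_zero fun z _ => ?_
    rcases eq_or_ne y z with rfl | h
    · simp
    · rw [← hx y z h, sub_self, mul_zero]

theorem IsShortestGain.balanced_of_det_eq_zero (hΘ : Θ.graph.Connected)
    (hg : Θ.IsShortestGain g) (hdet : (Θ.distLaplacian g).det = 0) : Θ.Balanced := by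
  obtain ⟨x, hx0, hx⟩ := Matrix.exists_mulVec_eq_zero_iff.mpr hdet
  rw [hg.mulVec_eq_zero_iff hΘ] at hx
  have hwalk : ∀ {u v : V} (p : Θ.graph.Walk u v), x u = Θ.walkGain p * x v := by
    intro u v p
    induction p with
    | nil => simp
    | cons h p ih =>
      rw [hx _ _ h.ne, hg.eq_gain_of_adj h, walkGain_cons, Circle.coe_mul, mul_assoc, ← ih]
  intro v c _
  obtain ⟨u, hu⟩ := Function.ne_iff.mp hx0
  obtain ⟨p⟩ := hΘ.preconnected u v
  -- Transport along walks keeps a nonzero value nonzero, so `x` vanishes nowhere.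
  have hv : x v ≠ 0 := fun h => hu (by rw [hwalk p, h, mul_zero, Pi.zero_apply])
  refine Circle.ext ?_
  rw [Circle.coe_one]
  exact mul_right_cancel₀ hv (by rw [one_mul]; exact (hwalk c).symm)

theorem IsShortestGain.distLaplacian_eq {g' : V → V → ℂ} (hg : Θ.IsShortestGain g)
    (hg' : Θ.IsShortestGain g') (hb : Θ.Balanced) : Θ.distLaplacian g = Θ.distLaplacian g' := by
  rw [distLaplacian, distLaplacian, sub_right_inj]
  ext y z
  rw [Matrix.of_apply, Matrix.of_apply]
  rcases eq_or_ne y z with rfl | h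
  · simp
  · obtain ⟨p, -, hp⟩ := hg y z h
    obtain ⟨q, -, hq⟩ := hg' y z h
    rw [hp, hq, hb.walkGain_eq p q]

theorem IsShortestGain.finrank_ker (hΘ : Θ.graph.Connected) (hg : Θ.IsShortestGain g)
    (hb : Θ.Balanced) : Module.finrank ℂ (Θ.distLaplacian g).mulVecLin.ker = 1 := by
  obtain ⟨r⟩ := hΘ.nonempty
  let P : ∀ y, Θ.graph.Walk y r := fun y => (hΘ.preconnected y r).some
  let θ : V → ℂ := fun y => Θ.walkGain (P y)
  have hgθ : ∀ y z, y ≠ z → θ y = g y z * θ z := by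
    intro y z h
    obtain ⟨p, -, hp⟩ := hg y z h
    rw [hp, ← Circle.coe_mul, ← walkGain_append, hb.walkGain_eq (p.append (P z)) (P y)]
  have hr : θ r = 1 := by simp only [θ, hb.walkGain_closed, Circle.coe_one]
  have hθ : θ ∈ (Θ.distLaplacian g).mulVecLin.ker :=
    LinearMap.mem_ker.mpr ((hg.mulVec_eq_zero_iff hΘ θ).mpr hgθ)
  have hne : (⟨θ, hθ⟩ : (Θ.distLaplacian g).mulVecLin.ker) ≠ 0 := by
    intro h
    have := congrFun (congrArg Subtype.val h) r
    exact one_ne_zero (hr.symm.trans this)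
  refine (finrank_eq_one_iff_of_nonzero' _ hne).mpr fun ⟨x, hx⟩ => ⟨x r, Subtype.ext ?_⟩
  have hx' := (hg.mulVec_eq_zero_iff hΘ x).mp (LinearMap.mem_ker.mp hx)
  ext y
  change x r * θ y = x y
  rcases eq_or_ne y r with rfl | h
  · rw [hr, mul_one]
  · rw [hx' y r h, hgθ y r h, hr, mul_one, mul_comm]

theorem IsShortestGain.rank_of_balanced (hΘ : Θ.graph.Connected) (hg : Θ.IsShortestGain g)
    (hb : Θ.Balanced) : (Θ.distLaplacian g).rank = Fintype.card V - 1 := by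
  have h := (Θ.distLaplacian g).mulVecLin.finrank_range_add_finrank_ker
  rw [hg.finrank_ker hΘ hb, Module.finrank_fintype_fun_eq_card] at h
  exact Nat.eq_sub_of_add_eq h

theorem IsShortestGain.det_eq_zero_iff (hΘ : Θ.graph.Connected) (hg : Θ.IsShortestGain g) :
    (Θ.distLaplacian g).det = 0 ↔ Θ.Balanced := by
  refine ⟨hg.balanced_of_det_eq_zero hΘ, fun hb => ?_⟩
  by_contra hdet
  have h := hg.rank_of_balanced hΘ hb
  rw [Matrix.rank_of_isUnit _ ((Matrix.isUnit_iff_isUnit_det _).mpr (Ne.isUnit hdet))] at h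
  have := hΘ.nonempty
  -- Excludes `n = 0`, where truncated subtraction gives `n - 1 = n`.
  have := Fintype.card_pos (α := V)
  omega

theorem IsShortestGain.rank_of_not_balanced (hΘ : Θ.graph.Connected) (hg : Θ.IsShortestGain g)
    (hb : ¬ Θ.Balanced) : (Θ.distLaplacian g).rank = Fintype.card V :=
  Matrix.rank_of_isUnit _ ((Matrix.isUnit_iff_isUnit_det _).mpr
    (Ne.isUnit fun h => hb ((hg.det_eq_zero_iff hΘ).mp h)))

end Laplacian

end TGainGraph

theorem mainTheorem1 {V : Type*} [Fintype V] [DecidableEq V] (Θ : TGainGraph V)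
    (hΘ : Θ.graph.Connected) (lt : V → V → Prop) [IsStrictTotalOrder V lt] :
    List.TFAE
      [(Θ.maxDistLaplacian lt).det = 0,
       (Θ.minDistLaplacian lt).det = 0,
       Θ.maxDistLaplacian lt = Θ.minDistLaplacian lt ∧ (Θ.maxDistLaplacian lt).det = 0,
       Θ.Balanced] ∧
    (Θ.Balanced →
      (Θ.maxDistLaplacian lt).rank = Fintype.card V - 1 ∧
      (Θ.minDistLaplacian lt).rank = Fintype.card V - 1) ∧
    (¬ Θ.Balanced →
      (Θ.maxDistLaplacian lt).rank = Fintype.card V ∧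
      (Θ.minDistLaplacian lt).rank = Fintype.card V) ∧
    (Θ.Balanced → ∀ (lt' : V → V → Prop) [IsStrictTotalOrder V lt'],
      Θ.maxDistLaplacian lt' = Θ.maxDistLaplacian lt ∧
      Θ.minDistLaplacian lt' = Θ.minDistLaplacian lt) := by
  have hmax := Θ.isShortestGain_maxAuxGain hΘ
  have hmin := Θ.isShortestGain_minAuxGain hΘ
  -- `maxDistLaplacian lt` is definitionally `distLaplacian` of `maxAuxGain lt`.
  have h1 : (Θ.maxDistLaplacian lt).det = 0 ↔ Θ.Balanced := (hmax lt).det_eq_zero_iff hΘ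
  have h2 : (Θ.minDistLaplacian lt).det = 0 ↔ Θ.Balanced := (hmin lt).det_eq_zero_iff hΘ
  refine ⟨?_, fun hb => ⟨(hmax lt).rank_of_balanced hΘ hb, (hmin lt).rank_of_balanced hΘ hb⟩,
    fun hb => ⟨(hmax lt).rank_of_not_balanced hΘ hb, (hmin lt).rank_of_not_balanced hΘ hb⟩,
    fun hb lt' _ => ⟨(hmax lt').distLaplacian_eq (hmax lt) hb,
      (hmin lt').distLaplacian_eq (hmin lt) hb⟩⟩
  tfae_have 1 ↔ 4 := h1
  tfae_have 2 ↔ 4 := h2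
  tfae_have 3 → 1 := And.right
  tfae_have 4 → 3 := fun hb => ⟨(hmax lt).distLaplacian_eq (hmin lt) hb, h1.mpr hb⟩
  tfae_finish
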